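/- Let $(X,\mathcal X,\mu)$ be a standard Borel probability space. For an invertible bi-measurable ergodic measure preserving map $T:X\to X$ and $k\ge 0$, let $X^{[k]}=X^{\{0,1\}^k}$ and let $T^{[k]}$ be the map applying $T$ in every coordinate. Let $\mathcal I^{[k]}(T)$ be the $\sigma$-algebra of measurable $T^{[k]}$-invariant subsets of $X^{[k]}$. Define probability measures $\mu^{[k]}_T$ on $X^{[k]}$ by $\mu_T^{[0]}=\mu$ and by letting $\mu_T^{[k+1]}$ be the relatively independent square of $\mu_T^{[k]}$ over $\mathcal I^{[k]}(T)$, that is, for bounded measurable $F',F''$ on $X^{[k]}$, $$\int_{X^{[k+1]}} F'(\mathbf x')F''(\mathbf x'')\,d\mu_T^{[k+1]}(\mathbf x',\mathbf x'')=\int_{X^{[k]}}\mathbb E(F'\mid\mathcal I^{[k]}(T))\,\mathbb E(F''\mid\mathcal I^{[k]}(T))\,d\mu_T^{[k]} .$$ For $k\ge 1$ and real-valued $f\in L^\infty(\mu)$ let $$|||f|||_{k,T}=\Big(\int_{X^{[k]}}\prod_{\epsilon\in\{0,1\}^k}f(x_\epsilon)\,d\mu^{[k]}_T(\mathbf x)\Big)^{1/2^k},$$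 and for $k\ge 0$ let $Z_k(X,T)$ be the factor given by the sub-$\sigma$-algebra $\mathcal Z_k(X,T)$ of $\mathcal X$ (unique up to null sets) such that, for $f\in L^\infty(\mu)$, $\mathbb E(f\mid\mathcal Z_k(X,T))=0$ if and only if $|||f|||_{k+1,T}=0$; equivalently, $A\in\mathcal X$ belongs to $\mathcal Z_k(X,T)$, up to null sets, if and only if $\int_A f\,d\mu=0$ for every $f\in L^\infty(\mu)$ with $|||f|||_{k+1,T}=0$. Finally let $\mathcal G(X,T)$ be the group of invertible measure preserving transformations $R$ of $X$ such that for every $k\ge1$ the map $R^{[k]}$ preserves $\mu^{[k]}_T$ and acts trivially on $\mathcal I^{[k]}(T)$, i.e. $\mu^{[k]}_T\big((R^{[k]})^{-1}A\,\triangle\, A\big)=0$ for all $A\in\mathcal I^{[k]}(T)$. Proposition. Let $T$ and $S$ be commuting invertible measure preserving transformations of $(X,\mathcal X,\mu)$, both ergodic. Then $S\in\mathcal G(X,T)$ and $\mathcal G(X,T)=\mathcal G(X,S)$. Moreover, for every integer $k\ge 0$, $\mu^{[k]}_T=\mu^{[k]}_S$; $\mathcal I^{[k]}(T)=\mathcal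 I^{[k]}(S)$ up to $\mu^{[k]}_T$-null sets; $Z_k(X,T)=Z_k(X,S)$ (i.e. $\mathcal Z_k(X,T)=\mathcal Z_k(X,S)$ up to $\mu$-null sets); and, if $k\ge1$, $|||f|||_{k,T}=|||f|||_{k,S}$ for every $f\in L^\infty(\mu)$. -/

import Mathlib

open MeasureTheory ProbabilityTheory

/-! Host–Kra cube measures, seminorms, the group `𝒢(X,T)` and the factors `Z_k(X,T)`. -/

namespace HostKra

section RelSquare

variable {Y : Type*} {m : MeasurableSpace Y} [mY : MeasurableSpace Y] [StandardBorelSpace Y]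

/-- The disintegration (regular conditional probability) of `ν` over the sub-σ-algebra `m`,
as a Markov kernel from `Y` to `Y`. -/
noncomputable def condKernel (ν : Measure Y) [IsFiniteMeasure ν]
    (hm : m ≤ mY) : Kernel Y Y :=
  (condExpKernel ν m).comap id (measurable_id'' hm)

instance (ν : Measure Y) [IsFiniteMeasure ν] (hm : m ≤ mY) :
    IsMarkovKernel (condKernel ν hm) := by
  unfold condKernel; infer_instance

/-- The relatively independent square of `ν` over the sub-σ-algebra `m`:
the measure `∫ ν_y × ν_y dν(y)` on `Y × Y`, where `ν = ∫ ν_y dν(y)` is the disintegration of `ν`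
over `m`. See `integral_relSquare` for its defining property. -/
noncomputable def relSquare (ν : Measure Y) [IsFiniteMeasure ν]
    (hm : m ≤ mY) : Measure (Y × Y) :=
  ν.bind (condKernel ν hm ×ₖ condKernel ν hm)

instance (ν : Measure Y) [IsProbabilityMeasure ν] (hm : m ≤ mY) :
    IsProbabilityMeasure (relSquare ν hm) := by
  unfold relSquare; infer_instance

/-- The defining property of the relatively independent square:
`∫ F'(y') F''(y'') = ∫ 𝔼(F' | m) 𝔼(F'' | m) dν` for bounded measurable `F'`, `F''`. -/
theorem integral_relSquare (ν : Measure Y) [IsProbabilityMeasure ν]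
    (hm : m ≤ mY) {F G : Y → ℝ} (hF : Measurable F) (hG : Measurable G) {C D : ℝ}
    (hFC : ∀ y, |F y| ≤ C) (hGD : ∀ y, |G y| ≤ D) :
    ∫ p, F p.1 * G p.2 ∂(relSquare ν hm) = ∫ y, (ν[F|m]) y * (ν[G|m]) y ∂ν := by
  have hFi : Integrable F ν := Integrable.of_bound hF.aestronglyMeasurable C (.of_forall hFC)
  have hGi : Integrable G ν := Integrable.of_bound hG.aestronglyMeasurable D (.of_forall hGD)
  have hint : Integrable (fun p : Y × Y => F p.1 * G p.2) (relSquare ν hm) := by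
    refine Integrable.of_bound (by fun_prop) (C * D) (.of_forall fun p => ?_)
    rw [Real.norm_eq_abs, abs_mul]
    exact mul_le_mul (hFC _) (hGD _) (abs_nonneg _) ((abs_nonneg _).trans (hFC p.1))
  unfold relSquare at hint ⊢
  have hbind : ν.bind (condKernel ν hm ×ₖ condKernel ν hm) =
      ((condKernel ν hm ×ₖ condKernel ν hm) ∘ₖ Kernel.const Unit ν) () := by
    rw [Kernel.comp_apply, Kernel.const_apply]
  rw [hbind] at hint ⊢
  rw [Kernel.integral_comp hint, Kernel.const_apply]
  refine integral_congr_ae ?_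
  filter_upwards [condExp_ae_eq_integral_condExpKernel hm hFi,
    condExp_ae_eq_integral_condExpKernel hm hGi] with y h1 h2
  rw [h1, h2, Kernel.prod_apply, integral_prod_mul]
  rfl

end RelSquare

section Cubes

/-- `X^{[k]} = X^{V_k}`, where `V_k = {0,1}^k`. -/
abbrev Cube (X : Type*) (k : ℕ) : Type _ := (Fin k → Bool) → X

/-- `T^{[k]} = T × ⋯ × T` (`2^k` times), acting on `X^{[k]}`. -/
def cubeMap {X : Type*} (T : X → X) (k : ℕ) : Cube X k → Cube X k := fun x ε => T (x ε)

/-- The identification `X^{[k]} × X^{[k]} = X^{[k+1]}`: a pair `(x', x'')` is the point `x` with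
`x_{ε0} = x'_ε` and `x_{ε1} = x''_ε`. -/
def glue (X : Type*) (k : ℕ) (p : Cube X k × Cube X k) : Cube X (k + 1) :=
  fun ε => if ε (Fin.last k) then p.2 (Fin.init ε) else p.1 (Fin.init ε)

variable {X : Type*} [MeasurableSpace X]

theorem measurable_glue (k : ℕ) : Measurable (glue X k) := by
  refine measurable_pi_lambda _ fun ε => ?_
  unfold glue
  by_cases h : ε (Fin.last k)
  · simp only [h, if_true]; fun_prop
  · simp only [h, Bool.false_eq_true, if_false]; fun_prop

/-- `ℐ^{[k]}(T)`: the σ-algebra of (measurable) `T^{[k]}`-invariant subsets of `X^{[k]}`. -/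
@[reducible]
def cubeInvariants (T : X → X) (k : ℕ) : MeasurableSpace (Cube X k) :=
  MeasurableSpace.invariants (cubeMap T k)

theorem cubeInvariants_le (T : X → X) (k : ℕ) : cubeInvariants T k ≤ MeasurableSpace.pi :=
  MeasurableSpace.invariants_le _

variable [StandardBorelSpace X]

/-- The measures `μ^{[k]}_T`, bundled with the fact that they are probability measures. -/
noncomputable def cubeProb (μ : Measure X) [IsProbabilityMeasure μ] (T : X → X) :
    (k : ℕ) → ProbabilityMeasure (Cube X k)
  | 0 => ⟨μ.map (fun x _ => x),
      Measure.isProbabilityMeasure_map (measurable_pi_lambda _ fun _ => measurable_id).aemeasurable⟩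
  | k + 1 => ⟨(relSquare (mY := MeasurableSpace.pi)
        (cubeProb μ T k : Measure (Cube X k)) (cubeInvariants_le T k)).map
        (glue X k),
      Measure.isProbabilityMeasure_map (measurable_glue k).aemeasurable⟩

/-- The measure `μ^{[k]}_T` on `X^{[k]}`: `μ^{[0]} = μ`, and `μ^{[k+1]}` is the relatively
independent square of `μ^{[k]}` over the `T^{[k]}`-invariant σ-algebra. -/
noncomputable def cubeMeasure (μ : Measure X) [IsProbabilityMeasure μ] (T : X → X) (k : ℕ) :
    Measure (Cube X k) :=
  cubeProb μ T k

instance (μ : Measure X) [IsProbabilityMeasure μ] (T : X → X) (k : ℕ) :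
    IsProbabilityMeasure (cubeMeasure μ T k) := by
  unfold cubeMeasure; infer_instance

/-- The seminorm `|||f|||_{k,T}` (for `k ≥ 1`): the `2^k`-th root of
`∫ ∏_{ε ∈ {0,1}^k} f(x_ε) dμ^{[k]}_T(x)`. -/
noncomputable def seminorm (μ : Measure X) [IsProbabilityMeasure μ] (T : X → X) (k : ℕ)
    (f : X → ℝ) : ℝ :=
  (∫ x, ∏ ε, f (x ε) ∂(cubeMeasure μ T k)) ^ (1 / (2 : ℝ) ^ k)

/-- `𝒢(X,T)`: the invertible measure preserving transformations `S` of `X` such that, for every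
`k ≥ 1`, the map `S^{[k]}` preserves `μ^{[k]}_T` and acts trivially on `ℐ^{[k]}(T)`
(up to `μ^{[k]}_T`-null sets). -/
def groupG (μ : Measure X) [IsProbabilityMeasure μ] (T : X → X) : Set (X ≃ᵐ X) :=
  {S | MeasurePreserving S μ μ ∧ ∀ k : ℕ, 1 ≤ k →
    MeasurePreserving (cubeMap S k) (cubeMeasure μ T k) (cubeMeasure μ T k) ∧
    ∀ A : Set (Cube X k), MeasurableSet[cubeInvariants T k] A →
      cubeMap S k ⁻¹' A =ᵐ[cubeMeasure μ T k] A}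

/-- The σ-algebra `𝒵_k(X,T)` of the factor `Z_k(X,T)`, containing all null sets of `X`.
It is the one determined by the property
`𝔼(f | 𝒵_k) = 0 ↔ |||f|||_{k+1,T} = 0` for `f ∈ L^∞(μ)`: a set `A` belongs to it
iff its indicator is orthogonal to every `f ∈ L^∞(μ)` with `|||f|||_{k+1,T} = 0`.
See `measurableSet_factorZ_iff`. -/
@[reducible]
def factorZ (μ : Measure X) [IsProbabilityMeasure μ] (T : X → X) (k : ℕ) : MeasurableSpace X :=
  MeasurableSpace.generateFrom {A | MeasurableSet A ∧
    ∀ f : X → ℝ, MemLp f ⊤ μ → seminorm μ T (k + 1) f = 0 → ∫ x in A, f x ∂μ = 0}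

/-- If `Z` is a sub-σ-algebra with `𝔼(f | Z) = 0 ↔ |||f|||_{k+1,T} = 0` for all `f ∈ L^∞(μ)`, then
`factorZ μ T k` is `Z` up to null sets. -/
theorem measurableSet_factorZ_iff {X : Type*} (Z : MeasurableSpace X) [mX : MeasurableSpace X]
    [StandardBorelSpace X] (μ : Measure X) [IsProbabilityMeasure μ] (T : X → X) (k : ℕ)
    (hZ : Z ≤ mX)
    (h : ∀ f : X → ℝ, MemLp f ⊤ μ → (μ[f|Z] =ᵐ[μ] 0 ↔ seminorm μ T (k + 1) f = 0))
    (A : Set X) :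
    MeasurableSet[factorZ μ T k] A ↔
      MeasurableSet A ∧ ∃ B, MeasurableSet[Z] B ∧ A =ᵐ[μ] B := by
  have key : ∀ A : Set X, (MeasurableSet A ∧ ∀ f : X → ℝ, MemLp f ⊤ μ →
      seminorm μ T (k + 1) f = 0 → ∫ x in A, f x ∂μ = 0) ↔
      (MeasurableSet A ∧ ∃ B, MeasurableSet[Z] B ∧ A =ᵐ[μ] B) := by
    intro A
    refine and_congr_right fun hA => ⟨fun hf => ?_, ?_⟩
    · set g : X → ℝ := A.indicator (fun _ => 1) with hg
      have hgtop : MemLp g ⊤ μ := (memLp_const (1 : ℝ)).indicator hA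
      have hgi : Integrable g μ := hgtop.integrable le_top
      set c : X → ℝ := μ[g|Z] with hc
      have hctop : MemLp c ⊤ μ := hgtop.condExp le_top
      have hci : Integrable c μ := integrable_condExp
      have hcm : StronglyMeasurable[Z] c := stronglyMeasurable_condExp
      have hcg : Integrable (c * g) μ := (hgtop.mul hctop (r := ⊤)).integrable le_top
      have hcc : Integrable (c * c) μ := (hctop.mul hctop (r := ⊤)).integrable le_top
      have hgg : Integrable (g * g) μ := (hgtop.mul hgtop (r := ⊤)).integrable le_top
      have h0 : μ[g - c|Z] =ᵐ[μ] 0 := by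
        filter_upwards [condExp_sub hgi hci Z] with x hx
        rw [hx, Pi.sub_apply, condExp_of_stronglyMeasurable hZ hcm hci]
        simp [hc]
      have h1 : ∫ x in A, (g - c) x ∂μ = 0 := hf _ (hgtop.sub hctop) ((h _ (hgtop.sub hctop)).1 h0)
      have h2 : ∫ x, (g * g) x ∂μ - ∫ x, (c * g) x ∂μ = 0 := by
        rw [← integral_sub hgg hcg, ← h1, ← integral_indicator hA]
        congr 1
        ext x
        by_cases hx : x ∈ A <;> simp [hg, hx]
      have h3 : ∫ x, (c * g) x ∂μ = ∫ x, (c * c) x ∂μ := by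
        rw [← integral_condExp hZ]
        exact integral_congr_ae (condExp_mul_of_stronglyMeasurable_left hcm hcg hgi)
      have h4 : ∫ x, (g x - c x) ^ 2 ∂μ = 0 := by
        have : (fun x => (g x - c x) ^ 2) =
            fun x => ((g * g) x - (c * g) x) - ((c * g) x - (c * c) x) := by
          ext x; simp only [Pi.mul_apply]; ring
        have e1 := integral_sub (hgg.sub hcg) (hcg.sub hcc)
        have e2 := integral_sub hgg hcg
        have e3 := integral_sub hcg hcc
        simp only [Pi.sub_apply] at e1
        rw [this, e1, e2, e3]
        linarith
      have h5 : Integrable (fun x => (g x - c x) ^ 2) μ := by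
        have := ((hgtop.sub hctop).mul (hgtop.sub hctop) (r := ⊤)).integrable le_top
        refine this.congr (.of_forall fun x => ?_)
        simp only [Pi.mul_apply, Pi.sub_apply]; ring
      rw [integral_eq_zero_iff_of_nonneg (fun x => sq_nonneg _) h5] at h4
      refine ⟨c ⁻¹' {1}, hcm.measurable (measurableSet_singleton 1), ?_⟩
      filter_upwards [h4] with x hx
      have hx' : g x = c x := by
        have : g x - c x = 0 := by simpa using hx
        linarith
      apply propext
      change x ∈ A ↔ c x = 1
      rw [← hx']
      by_cases hxA : x ∈ A <;> simp [hg, hxA]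
    · rintro ⟨B, hB, hAB⟩ f hf hf0
      rw [setIntegral_congr_set hAB, ← setIntegral_condExp hZ (hf.integrable le_top) hB]
      have := (h f hf).2 hf0
      rw [integral_congr_ae (ae_restrict_of_ae this)]
      simp
  have hgen : factorZ μ T k =
      { MeasurableSet' := fun A => MeasurableSet A ∧ ∃ B, MeasurableSet[Z] B ∧ A =ᵐ[μ] B
        measurableSet_empty := ⟨.empty, ∅, @MeasurableSet.empty _ Z, .rfl⟩
        measurableSet_compl := fun A ⟨hA, B, hB, hAB⟩ =>
          ⟨hA.compl, Bᶜ, @MeasurableSet.compl _ _ Z hB, hAB.compl⟩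
        measurableSet_iUnion := fun A hA => by
          choose h1 B hB hAB using hA
          exact ⟨.iUnion h1, ⋃ i, B i, @MeasurableSet.iUnion _ _ Z _ _ hB,
            Filter.EventuallyEq.countable_iUnion hAB⟩ } := by
    unfold factorZ
    simp_rw [key]
    refine le_antisymm (MeasurableSpace.generateFrom_le fun A hA => hA) fun A hA => ?_
    exact MeasurableSpace.measurableSet_generateFrom hA
  rw [hgen]
  rfl

/-- `𝒢(X,T)` is a group under composition. -/
theorem refl_mem_groupG (μ : Measure X) [IsProbabilityMeasure μ] (T : X → X) :
    MeasurableEquiv.refl X ∈ groupG μ T :=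
  ⟨.id μ, fun _ _ => ⟨.id _, fun _ _ => .rfl⟩⟩

theorem trans_mem_groupG (μ : Measure X) [IsProbabilityMeasure μ] (T : X → X) {S R : X ≃ᵐ X}
    (hS : S ∈ groupG μ T) (hR : R ∈ groupG μ T) : S.trans R ∈ groupG μ T :=
  ⟨hR.1.comp hS.1, fun k hk => ⟨(hR.2 k hk).1.comp (hS.2 k hk).1, fun A hA =>
    ((hS.2 k hk).1.quasiMeasurePreserving.preimage_ae_eq ((hR.2 k hk).2 A hA)).trans
      ((hS.2 k hk).2 A hA)⟩⟩

theorem symm_mem_groupG (μ : Measure X) [IsProbabilityMeasure μ] (T : X → X) {S : X ≃ᵐ X}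
    (hS : S ∈ groupG μ T) : S.symm ∈ groupG μ T := by
  refine ⟨hS.1.symm, fun k hk => ?_⟩
  have h1 : MeasurePreserving (cubeMap S.symm k) (cubeMeasure μ T k) (cubeMeasure μ T k) :=
    MeasurePreserving.symm (MeasurableEquiv.piCongrRight fun _ => S) (hS.2 k hk).1
  refine ⟨h1, fun A hA => ?_⟩
  have h2 := h1.quasiMeasurePreserving.preimage_ae_eq ((hS.2 k hk).2 A hA)
  have h3 : cubeMap S.symm k ⁻¹' (cubeMap S k ⁻¹' A) = A := by
    ext x
    have : cubeMap S k (cubeMap S.symm k x) = x := by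
      funext ε; simp [cubeMap]
    simp [this]
  rw [h3] at h2
  exact h2.symm

end Cubes

end HostKra

/-! Everything rests on one claim, `measurePreserving_and_preimage_ae_eq_of_commute`: if R preserves
μ and commutes with the ergodic map T, then each R^{[k]} preserves μ^{[k]}_T and fixes every
T^{[k]}-invariant set up to null sets. The proof is by induction on k. At k = 0 ergodicity leaves
only null and conull invariant sets. Triviality at level k makes R^{[k]} preserve almost every fibre
measure of the disintegration over the invariant sets, so the next measure is preserved.

Triviality at level k + 1 is the heart (`prodMap_preimage_ae_eq_relSquare`). Let A be U ×
U-invariant and regard its sections A_y as points of the separable measure algebra of the fibre.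
Since V fixes U-invariant sets, A_{Vz} is approximated by A_{U^n z} for some n depending on z. The
error is a U-invariant function of z because V commutes with U, so one n serves almost the whole
fibre. There V can be replaced by U^n, one coordinate at a time, so (V × V)⁻¹A is close to (U^n ×
U^n)⁻¹A = A.

Applied to (T, S) and to (S, T), the claim shows that the two invariant σ-algebras agree modulo null
sets as soon as the measures agree. A relatively independent square only sees its σ-algebra modulo
null sets, so a second induction gives equality of the measures. Seminorms, factors and groups
follow. -/

namespace HostKra

open scoped ENNReal symmDiff

/-- A countable algebra of sets generating a standard Borel structure is dense for every finite
measure. -/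
theorem exists_seq_measureDense (Y : Type*) [mY : MeasurableSpace Y] [StandardBorelSpace Y] :
    ∃ t : ℕ → Set Y, (∀ n, MeasurableSet (t n)) ∧ IsPiSystem (Set.range t) ∧
      mY = MeasurableSpace.generateFrom (Set.range t) ∧
      ∀ (ρ : Measure Y) [IsFiniteMeasure ρ] (s : Set Y), MeasurableSet s →
        ∀ ε : ℝ, 0 < ε → ∃ n, ρ (s ∆ t n) < ENNReal.ofReal ε := by
  obtain ⟨b, hbc, hb⟩ := MeasurableSpace.CountablyGenerated.isCountablyGenerated (α := Y)
  have hc := countable_generateSetAlgebra hbc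
  have halg := isSetAlgebra_generateSetAlgebra (𝒜 := b)
  obtain ⟨t, ht⟩ := hc.exists_eq_range ⟨∅, halg.empty_mem⟩
  have hgen : mY = MeasurableSpace.generateFrom (generateSetAlgebra b) := by
    rw [generateFrom_generateSetAlgebra_eq, hb]
  rw [ht] at hgen halg
  refine ⟨t, fun n => ?_, fun s hs u hu _ => halg.inter_mem hs hu, hgen, fun ρ _ s hs ε hε => ?_⟩
  · rw [hgen]; exact MeasurableSpace.measurableSet_generateFrom ⟨n, rfl⟩
  · obtain ⟨u, ⟨n, rfl⟩, hu⟩ :=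
      (Measure.MeasureDense.of_generateFrom_isSetAlgebra_finite ρ halg hgen).approx s hs
        (measure_ne_top _ _) ε hε
    exact ⟨n, hu⟩

/-! ### Disintegration over a sub-σ-algebra -/

section Kernel

variable {Y : Type*} {m : MeasurableSpace Y} [mY : MeasurableSpace Y] [StandardBorelSpace Y]
  {ν : Measure Y} [IsProbabilityMeasure ν]

theorem measurable_condKernel_apply (hm : m ≤ mY) {s : Set Y} (hs : MeasurableSet s) :
    Measurable[m] fun y => condKernel ν hm y s :=
  measurable_condExpKernel hs

theorem condKernel_real_ae_eq (hm : m ≤ mY) {s : Set Y} (hs : MeasurableSet s) :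
    (fun y => (condKernel ν hm y).real s) =ᵐ[ν] ν⟦s|m⟧ :=
  condExpKernel_ae_eq_condExp hm hs

theorem bind_condKernel (hm : m ≤ mY) : ν.bind (condKernel ν hm) = ν := by
  ext s hs
  rw [Measure.bind_apply hs (Kernel.aemeasurable _)]
  have h1 : ∫⁻ y, condKernel ν hm y s ∂ν = ∫⁻ y, ENNReal.ofReal ((condKernel ν hm y).real s) ∂ν := by
    simp
  have hint : Integrable (fun y => (condKernel ν hm y).real s) ν :=
    integrable_toReal_condExpKernel hs
  rw [h1, ← ofReal_integral_eq_lintegral_ofReal hint (.of_forall fun _ => measureReal_nonneg),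
    integral_congr_ae (condKernel_real_ae_eq hm hs), integral_condExp hm, integral_indicator hs]
  simp

theorem ae_ae_condKernel (hm : m ≤ mY) {p : Y → Prop} (h : ∀ᵐ y ∂ν, p y) :
    ∀ᵐ y ∂ν, ∀ᵐ z ∂condKernel ν hm y, p z := by
  rw [← bind_condKernel (ν := ν) hm] at h
  exact Measure.ae_ae_of_ae_bind (Kernel.aemeasurable _) h

/-- Disintegration measures give full or zero mass to the sets of the σ-algebra. -/
theorem ae_mem_iff_of_measurableSet (hm : m ≤ mY) {D : Set Y} (hD : MeasurableSet[m] D) :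
    ∀ᵐ y ∂ν, ∀ᵐ z ∂condKernel ν hm y, (z ∈ D ↔ y ∈ D) := by
  have key : ∀ E : Set Y, MeasurableSet[m] E →
      ∀ᵐ y ∂ν, y ∉ E → ∀ᵐ z ∂condKernel ν hm y, z ∉ E := by
    intro E hE
    have h := condKernel_real_ae_eq (ν := ν) hm (hm E hE)
    rw [condExp_of_stronglyMeasurable hm (stronglyMeasurable_const.indicator hE)
      ((integrable_const _).indicator (hm E hE))] at h
    filter_upwards [h] with y hy hyE
    rw [Set.indicator_of_notMem hyE, measureReal_eq_zero_iff] at hy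
    exact measure_eq_zero_iff_ae_notMem.1 hy
  filter_upwards [key D hD, key Dᶜ hD.compl] with y h1 h2
  by_cases hy : y ∈ D
  · filter_upwards [h2 (by simpa using hy)] with z hz
    simpa [hy] using hz
  · filter_upwards [h1 hy] with z hz
    simp [hy, hz]

/-- Functions measurable with respect to the σ-algebra are constant on almost every fibre. -/
theorem ae_ae_eq_of_measurable {Z : Type*} [MeasurableSpace Z]
    [MeasurableSpace.CountablySeparated Z] (hm : m ≤ mY) {g : Y → Z} (hg : Measurable[m] g) :
    ∀ᵐ y ∂ν, ∀ᵐ z ∂condKernel ν hm y, g z = g y := by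
  obtain ⟨S, hS, hsep⟩ := exists_seq_separating Z MeasurableSet.empty Set.univ
  have h := ae_all_iff.2 fun n => ae_mem_iff_of_measurableSet (ν := ν) hm (hg (hS n))
  filter_upwards [h] with y hy
  filter_upwards [ae_all_iff.2 hy] with z hz
  exact hsep _ trivial _ trivial hz

omit [StandardBorelSpace Y] [IsProbabilityMeasure ν] in
theorem ae_comp_eq_of_measurable {Z : Type*} [MeasurableSpace Z]
    [MeasurableSpace.CountablySeparated Z] {V : Y → Y}
    (hV : ∀ D, MeasurableSet[m] D → V ⁻¹' D =ᵐ[ν] D) {g : Y → Z} (hg : Measurable[m] g) :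
    ∀ᵐ y ∂ν, g (V y) = g y := by
  obtain ⟨S, hS, hsep⟩ := exists_seq_separating Z MeasurableSet.empty Set.univ
  have h := ae_all_iff.2 fun n => (hV _ (hg (hS n))).mem_iff
  filter_upwards [h] with y hy
  exact hsep _ trivial _ trivial hy

omit [StandardBorelSpace Y] in
theorem measure_ext_of_seq {t : ℕ → Set Y} (hpi : IsPiSystem (Set.range t))
    (hgen : mY = MeasurableSpace.generateFrom (Set.range t)) {ρ σ : Measure Y}
    [IsProbabilityMeasure ρ] [IsProbabilityMeasure σ] (h : ∀ n, ρ (t n) = σ (t n)) : ρ = σ :=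
  ext_of_generate_finite _ hgen hpi (by rintro _ ⟨n, rfl⟩; exact h n) (by simp)

/-- The fibre measure is encoded by its values on a countable generating π-system, an `m`-measurable
map into sequences, and such maps are constant on almost every fibre. -/
theorem ae_ae_condKernel_eq (hm : m ≤ mY) :
    ∀ᵐ y ∂ν, ∀ᵐ z ∂condKernel ν hm y, condKernel ν hm z = condKernel ν hm y := by
  obtain ⟨t, ht, hpi, hgen, -⟩ := exists_seq_measureDense Y
  have hg : Measurable[m] fun y n => condKernel ν hm y (t n) :=
    @measurable_pi_lambda _ _ _ m _ _ fun n => measurable_condKernel_apply hm (ht n)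
  filter_upwards [ae_ae_eq_of_measurable (ν := ν) hm hg] with y hy
  filter_upwards [hy] with z hz
  exact measure_ext_of_seq hpi hgen fun n => congr_fun hz n

theorem ae_condKernel_comp_eq (hm : m ≤ mY) {V : Y → Y}
    (hV : ∀ D, MeasurableSet[m] D → V ⁻¹' D =ᵐ[ν] D) :
    ∀ᵐ y ∂ν, condKernel ν hm (V y) = condKernel ν hm y := by
  obtain ⟨t, ht, hpi, hgen, -⟩ := exists_seq_measureDense Y
  have hg : Measurable[m] fun y n => condKernel ν hm y (t n) :=
    @measurable_pi_lambda _ _ _ m _ _ fun n => measurable_condKernel_apply hm (ht n)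
  filter_upwards [ae_comp_eq_of_measurable hV hg] with y hy
  exact measure_ext_of_seq hpi hgen fun n => congr_fun hy n

-- For D in `m`, the sets D ∩ V⁻¹s and V⁻¹(D ∩ s) agree up to a null set, and the latter has the
-- measure of D ∩ s.
omit [StandardBorelSpace Y] in
theorem condExp_preimage_ae_eq (hm : m ≤ mY) {V : Y → Y} (hVν : MeasurePreserving V ν ν)
    (hV : ∀ D, MeasurableSet[m] D → V ⁻¹' D =ᵐ[ν] D) {s : Set Y} (hs : MeasurableSet s) :
    ν⟦s|m⟧ =ᵐ[ν] ν⟦V ⁻¹' s|m⟧ := by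
  have hi : ∀ {u : Set Y}, MeasurableSet u → Integrable (u.indicator fun _ => (1 : ℝ)) ν :=
    fun hu => (integrable_const _).indicator hu
  refine ae_eq_condExp_of_forall_setIntegral_eq hm (hi (hVν.measurable hs))
    (fun _ _ _ => integrable_condExp.integrableOn) (fun D hD _ => ?_)
    stronglyMeasurable_condExp.aestronglyMeasurable
  rw [setIntegral_condExp hm (hi hs) hD, setIntegral_indicator hs,
    setIntegral_indicator (hVν.measurable hs)]
  simp only [integral_const, smul_eq_mul, mul_one, measureReal_def, Measure.restrict_apply_univ]
  have h1 : (D ∩ V ⁻¹' s : Set Y) =ᵐ[ν] (V ⁻¹' (D ∩ s) : Set Y) :=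
    (hV D hD).symm.inter (ae_eq_refl _)
  rw [measure_congr h1, hVν.measure_preimage ((hm D hD).inter hs).nullMeasurableSet]

/-- A measure preserving map acting trivially on the σ-algebra preserves almost every fibre. -/
theorem ae_measurePreserving_condKernel (hm : m ≤ mY) {V : Y → Y} (hVν : MeasurePreserving V ν ν)
    (hV : ∀ D, MeasurableSet[m] D → V ⁻¹' D =ᵐ[ν] D) :
    ∀ᵐ y ∂ν, MeasurePreserving V (condKernel ν hm y) (condKernel ν hm y) := by
  obtain ⟨t, ht, hpi, hgen, -⟩ := exists_seq_measureDense Y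
  have h : ∀ n, ∀ᵐ y ∂ν, condKernel ν hm y (V ⁻¹' t n) = condKernel ν hm y (t n) := fun n => by
    filter_upwards [condKernel_real_ae_eq hm (ht n), condKernel_real_ae_eq hm (hVν.measurable (ht n)),
      condExp_preimage_ae_eq hm hVν hV (ht n)] with y h1 h2 h3
    rw [← measureReal_eq_measureReal_iff, h1, h2, h3]
  filter_upwards [ae_all_iff.2 h] with y hy
  have := Measure.isProbabilityMeasure_map (μ := condKernel ν hm y) hVν.measurable.aemeasurable
  refine ⟨hVν.measurable, measure_ext_of_seq hpi hgen fun n => ?_⟩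
  rw [Measure.map_apply hVν.measurable (ht n), hy n]

theorem measurePreserving_relSquare (hm : m ≤ mY) {V : Y → Y} (hVν : MeasurePreserving V ν ν)
    (hV : ∀ D, MeasurableSet[m] D → V ⁻¹' D =ᵐ[ν] D) :
    MeasurePreserving (Prod.map V V) (relSquare ν hm) (relSquare ν hm) := by
  have hmeas : Measurable (Prod.map V V) := hVν.measurable.prodMap hVν.measurable
  refine ⟨hmeas, ?_⟩
  ext s hs
  rw [Measure.map_apply hmeas hs, relSquare, Measure.bind_apply (hmeas hs) (Kernel.aemeasurable _),
    Measure.bind_apply hs (Kernel.aemeasurable _)]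
  refine lintegral_congr_ae ?_
  filter_upwards [ae_measurePreserving_condKernel hm hVν hV] with y hy
  rw [Kernel.prod_apply]
  exact (hy.prod hy).measure_preimage hs.nullMeasurableSet

/-- σ-algebras with the same completion define the same relatively independent square. -/
theorem relSquare_eq_of_ae_eq {Y : Type*} {m₁ m₂ : MeasurableSpace Y} [mY : MeasurableSpace Y]
    [StandardBorelSpace Y] {ν : Measure Y} [IsProbabilityMeasure ν] (h₁ : m₁ ≤ mY) (h₂ : m₂ ≤ mY)
    (h₁₂ : m₁ ≤ eventuallyMeasurableSpace m₂ (ae ν))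
    (h₂₁ : m₂ ≤ eventuallyMeasurableSpace m₁ (ae ν)) :
    relSquare ν h₁ = relSquare ν h₂ := by
  have hsup : m₁ ⊔ m₂ ≤ mY := sup_le h₁ h₂
  -- Neither σ-algebra need contain the other, so both conditional expectations are compared with
  -- the one over the join.
  have key : ∀ m' : MeasurableSpace Y, m' ≤ m₁ ⊔ m₂ →
      m₁ ⊔ m₂ ≤ eventuallyMeasurableSpace m' (ae ν) → ∀ s, MeasurableSet[mY] s →
      ν⟦s|m'⟧ =ᵐ[ν] ν⟦s|m₁ ⊔ m₂⟧ := by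
    intro m' hm' hm'' s hs
    have hi : Integrable (s.indicator fun _ => (1 : ℝ)) ν := (integrable_const _).indicator hs
    refine ae_eq_condExp_of_forall_setIntegral_eq hsup hi
      (fun _ _ _ => integrable_condExp.integrableOn) (fun D hD _ => ?_)
      (stronglyMeasurable_condExp.mono hm').aestronglyMeasurable
    obtain ⟨E, hE, hDE⟩ := hm'' D hD
    rw [setIntegral_congr_set hDE, setIntegral_congr_set hDE,
      setIntegral_condExp (hm'.trans hsup) hi hE]
  obtain ⟨t, ht, hpi, hgen, -⟩ := exists_seq_measureDense Y
  have h : ∀ n, ∀ᵐ y ∂ν, condKernel ν h₁ y (t n) = condKernel ν h₂ y (t n) := fun n => by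
    filter_upwards [condKernel_real_ae_eq h₁ (ht n), condKernel_real_ae_eq h₂ (ht n),
      key m₁ le_sup_left (sup_le le_eventuallyMeasurableSpace h₂₁) _ (ht n),
      key m₂ le_sup_right (sup_le h₁₂ le_eventuallyMeasurableSpace) _ (ht n)] with y e1 e2 e3 e4
    rw [← measureReal_eq_measureReal_iff, e1, e2, e3, e4]
  refine Measure.bind_congr_right ?_
  filter_upwards [ae_all_iff.2 h] with y hy
  rw [Kernel.prod_apply, Kernel.prod_apply, measure_ext_of_seq hpi hgen hy]

end Kernel


/-! ### Replacing V by an iterate of U on one fibre -/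

theorem prodMap_iterate_preimage {Y : Type*} {U : Y → Y} {A : Set (Y × Y)}
    (hUA : Prod.map U U ⁻¹' A = A) (n : ℕ) : Prod.map U^[n] U^[n] ⁻¹' A = A := by
  rw [← Prod.map_iterate, Set.preimage_iterate_eq, Function.iterate_fixed hUA]

/-- If the sections of an invariant set move under `V` almost as under an iterate of `U`,
then the set is almost invariant under `V × V`. -/
theorem measure_prodMap_preimage_symmDiff_le {Y : Type*} [MeasurableSpace Y] {ρ : Measure Y}
    [IsProbabilityMeasure ρ] {U V : Y → Y} (hU : MeasurePreserving U ρ ρ)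
    (hV : MeasurePreserving V ρ ρ) {A : Set (Y × Y)} (hA : MeasurableSet A)
    (hUA : Prod.map U U ⁻¹' A = A) (n : ℕ) (δ : ℝ≥0∞)
    (h₁ : ∀ᵐ y ∂ρ, ρ ((Prod.mk (V y) ⁻¹' A) ∆ (Prod.mk (U^[n] y) ⁻¹' A)) ≤ δ)
    (h₂ : ∀ᵐ y ∂ρ, ρ ((Prod.mk (V y) ⁻¹' (Prod.swap ⁻¹' A)) ∆
      (Prod.mk (U^[n] y) ⁻¹' (Prod.swap ⁻¹' A))) ≤ δ) :
    (ρ.prod ρ) ((Prod.map V V ⁻¹' A) ∆ A) ≤ δ + δ := by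
  have hUn := hU.iterate n
  have mP : MeasurableSet (Prod.map V V ⁻¹' A) := (hV.measurable.prodMap hV.measurable) hA
  have mQ : MeasurableSet (Prod.map U^[n] V ⁻¹' A) := (hUn.measurable.prodMap hV.measurable) hA
  have mR : MeasurableSet (Prod.map U^[n] U^[n] ⁻¹' A) :=
    (hUn.measurable.prodMap hUn.measurable) hA
  have e1 : (ρ.prod ρ) ((Prod.map V V ⁻¹' A) ∆ (Prod.map U^[n] V ⁻¹' A)) ≤ δ := by
    rw [Measure.prod_apply (mP.symmDiff mQ)]
    calc _ ≤ ∫⁻ _, δ ∂ρ := by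
          refine lintegral_mono_ae ?_
          filter_upwards [h₁] with y hy
          refine le_trans (le_of_eq ?_) hy
          -- The section over y is the V-preimage of A_{Vy} ∆ A_{U^n y}, so V drops out.
          rw [← hV.measure_preimage ((measurable_prodMk_left hA).symmDiff
            (measurable_prodMk_left hA)).nullMeasurableSet]
          rfl
      _ = δ := by simp
  have e2 : (ρ.prod ρ) ((Prod.map U^[n] V ⁻¹' A) ∆ (Prod.map U^[n] U^[n] ⁻¹' A)) ≤ δ := by
    -- The second coordinate is now the one being changed, hence the swapped set.
    rw [Measure.prod_apply_symm (mQ.symmDiff mR)]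
    have mS : MeasurableSet (Prod.swap ⁻¹' A) := measurable_swap hA
    calc _ ≤ ∫⁻ _, δ ∂ρ := by
          refine lintegral_mono_ae ?_
          filter_upwards [h₂] with y hy
          refine le_trans (le_of_eq ?_) hy
          rw [← hUn.measure_preimage ((measurable_prodMk_left mS).symmDiff
            (measurable_prodMk_left mS)).nullMeasurableSet]
          rfl
      _ = δ := by simp
  have e3 := measure_symmDiff_le (μ := ρ.prod ρ) (Prod.map V V ⁻¹' A) (Prod.map U^[n] V ⁻¹' A)
    (Prod.map U^[n] U^[n] ⁻¹' A)
  rw [prodMap_iterate_preimage hUA] at e2 e3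
  exact e3.trans (add_le_add e1 e2)

/-! ### Recurrence and triviality on the relative square -/

section Recurrence

variable {Y : Type*} [mY : MeasurableSpace Y] {ν : Measure Y} [IsProbabilityMeasure ν]
  {U V : Y → Y}

/-- The points whose forward U-orbit meets E form a set that is U-invariant up to null sets, hence
also V-invariant up to null sets. If Vz lies in E, then Vz lies in this set, and so does almost
every such z. -/
theorem ae_exists_iterate_mem (hU : MeasurePreserving U ν ν) (hV : MeasurePreserving V ν ν)
    (htriv : ∀ D, MeasurableSet[MeasurableSpace.invariants U] D → V ⁻¹' D =ᵐ[ν] D)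
    {E : Set Y} (hE : MeasurableSet E) : ∀ᵐ z ∂ν, V z ∈ E → ∃ n, U^[n] z ∈ E := by
  set G : Set Y := ⋃ n, U^[n] ⁻¹' E with hG
  have mG : MeasurableSet G := .iUnion fun n => hU.measurable.iterate n hE
  have hsub : U ⁻¹' G ⊆ G := by
    intro z hz
    obtain ⟨n, hn⟩ := Set.mem_iUnion.1 hz
    exact Set.mem_iUnion.2 ⟨n + 1, hn⟩
  -- The inclusion is between sets of equal finite measure.
  have hUG : U ⁻¹' G =ᵐ[ν] G := ae_eq_of_subset_of_measure_ge hsub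
    (hU.measure_preimage mG.nullMeasurableSet).ge (hU.measurable mG).nullMeasurableSet
    (measure_ne_top _ _)
  obtain ⟨t, mt, htG, hUt⟩ :=
    hU.quasiMeasurePreserving.exists_preimage_eq_of_preimage_ae mG.nullMeasurableSet hUG
  have hVG : V ⁻¹' G =ᵐ[ν] G := (hV.quasiMeasurePreserving.preimage_ae_eq htG).symm.trans
    ((htriv t ⟨mt, hUt⟩).trans htG)
  filter_upwards [hVG.mem_iff] with z hz hzE
  exact Set.mem_iUnion.1 (hz.1 (Set.mem_iUnion.2 ⟨0, hzE⟩))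

variable [StandardBorelSpace Y]

theorem ae_ae_mem_iff_of_preimage_ae_eq (hU : MeasurePreserving U ν ν) {D : Set Y}
    (hD : MeasurableSet D) (hUD : U ⁻¹' D =ᵐ[ν] D) :
    ∀ᵐ y ∂ν, ∀ᵐ z ∂condKernel ν (MeasurableSpace.invariants_le U) y, (z ∈ D ↔ y ∈ D) := by
  obtain ⟨t, mt, htD, hUt⟩ :=
    hU.quasiMeasurePreserving.exists_preimage_eq_of_preimage_ae hD.nullMeasurableSet hUD
  have hle := MeasurableSpace.invariants_le U
  filter_upwards [ae_ae_condKernel hle htD.mem_iff, htD.mem_iff,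
    ae_mem_iff_of_measurableSet (ν := ν) hle (D := t)
      (MeasurableSpace.measurableSet_invariants.2 ⟨mt, hUt⟩)] with y h1 h2 h3
  filter_upwards [h1, h3] with z h4 h5
  rw [← h4, h5, h2]

theorem ae_condKernel_invariants_iterate (n : ℕ) :
    ∀ᵐ y ∂ν, condKernel ν (MeasurableSpace.invariants_le U) (U^[n] y) =
      condKernel ν (MeasurableSpace.invariants_le U) y :=
  ae_condKernel_comp_eq _ fun D hD =>
    .of_eq (MeasurableSpace.le_invariants_iterate U n D hD).2

/-- The `κ_z`-measure of the set of `w` such that exactly one of `(f z, w)`, `(g z, w)` lies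
in `A`, where `κ` is the disintegration over the `U`-invariant sets. -/
noncomputable def sectionDist (ν : Measure Y) [IsProbabilityMeasure ν] (U : Y → Y)
    (A : Set (Y × Y)) (f g : Y → Y) (z : Y) : ℝ≥0∞ :=
  condKernel ν (MeasurableSpace.invariants_le U) z
    ((Prod.mk (f z) ⁻¹' A) ∆ (Prod.mk (g z) ⁻¹' A))

theorem measurable_sectionDist {A : Set (Y × Y)} (hA : MeasurableSet A) {f g : Y → Y}
    (hf : Measurable f) (hg : Measurable g) : Measurable (sectionDist ν U A f g) := by
  have h : ∀ {f : Y → Y}, Measurable f → MeasurableSet (Prod.map f id ⁻¹' A) := fun hf =>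
    hf.prodMap measurable_id hA
  exact Kernel.measurable_kernel_prodMk_left
    (κ := condKernel ν (MeasurableSpace.invariants_le U)) ((h hf).symmDiff (h hg))

/-- Replacing z by Uz leaves the fibre measure unchanged and applies U to both base points;
invariance of A and of the fibre measure under U cancels this. -/
theorem sectionDist_comp_ae_eq (hU : MeasurePreserving U ν ν) (hUV : ∀ y, V (U y) = U (V y))
    {A : Set (Y × Y)} (hA : MeasurableSet A) (hUA : Prod.map U U ⁻¹' A = A) (n : ℕ) :
    ∀ᵐ z ∂ν, sectionDist ν U A V U^[n] (U z) = sectionDist ν U A V U^[n] z := by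
  filter_upwards [ae_condKernel_invariants_iterate (ν := ν) (U := U) 1,
    ae_measurePreserving_condKernel (MeasurableSpace.invariants_le U) hU
      (fun D hD => .of_eq hD.2)] with z h1 h2
  have hU' : ∀ a, U ⁻¹' (Prod.mk (U a) ⁻¹' A) = Prod.mk a ⁻¹' A := fun a => by
    conv_rhs => rw [← hUA]
    rfl
  rw [Function.iterate_one] at h1
  unfold sectionDist
  rw [h1, hUV, (Function.Commute.self_iterate U n).eq z |>.symm,
    ← h2.measure_preimage ((measurable_prodMk_left hA).symmDiff
    (measurable_prodMk_left hA)).nullMeasurableSet, Set.preimage_symmDiff, hU', hU']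

/-- Choose members of a countable dense family near the sections of A and B over Vz, and apply
recurrence to the set of points whose sections are near these members. Intersecting the conditions
for A and B yields a common n; the triangle inequality through the chosen members gives twice ε. -/
theorem ae_exists_sectionDist_le (hU : MeasurePreserving U ν ν) (hV : MeasurePreserving V ν ν)
    (htriv : ∀ D, MeasurableSet[MeasurableSpace.invariants U] D → V ⁻¹' D =ᵐ[ν] D)
    {A B : Set (Y × Y)} (hA : MeasurableSet A) (hB : MeasurableSet B) {ε : ℝ} (hε : 0 < ε) :
    ∀ᵐ z ∂ν, ∃ n, sectionDist ν U A V U^[n] z ≤ ENNReal.ofReal ε + ENNReal.ofReal ε ∧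
      sectionDist ν U B V U^[n] z ≤ ENNReal.ofReal ε + ENNReal.ofReal ε := by
  obtain ⟨t, ht, -, -, hdense⟩ := exists_seq_measureDense Y
  set κ := condKernel ν (MeasurableSpace.invariants_le U) with hκ
  have mE : ∀ {A : Set (Y × Y)}, MeasurableSet A → ∀ i,
      Measurable fun z => κ z ((Prod.mk z ⁻¹' A) ∆ t i) := fun hA i =>
    Kernel.measurable_kernel_prodMk_left (hA.symmDiff (measurable_snd (ht i)))
  have hrec := fun i j => ae_exists_iterate_mem hU hV htriv
    (E := {z | κ z ((Prod.mk z ⁻¹' A) ∆ t i) < ENNReal.ofReal ε} ∩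
      {z | κ z ((Prod.mk z ⁻¹' B) ∆ t j) < ENNReal.ofReal ε})
    ((measurableSet_lt (mE hA i) measurable_const).inter
      (measurableSet_lt (mE hB j) measurable_const))
  filter_upwards [ae_all_iff.2 fun i => ae_all_iff.2 (hrec i),
    ae_all_iff.2 fun n => ae_condKernel_invariants_iterate (ν := ν) (U := U) n,
    ae_condKernel_comp_eq (MeasurableSpace.invariants_le U) htriv] with z h1 h2 h3
  obtain ⟨i, hi⟩ := hdense (κ (V z)) (Prod.mk (V z) ⁻¹' A) (measurable_prodMk_left hA) ε hε
  obtain ⟨j, hj⟩ := hdense (κ (V z)) (Prod.mk (V z) ⁻¹' B) (measurable_prodMk_left hB) ε hε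
  obtain ⟨n, hn⟩ := h1 i j ⟨hi, hj⟩
  simp only [Set.mem_inter_iff, Set.mem_ofPred_eq] at hn
  -- Distances measured in the fibres of U^n z and of Vz are both distances in the fibre of z.
  rw [hκ, h2 n] at hn
  rw [hκ, h3] at hi hj
  refine ⟨n, (measure_symmDiff_le _ (t i) _).trans (add_le_add hi.le ?_),
    (measure_symmDiff_le _ (t j) _).trans (add_le_add hj.le ?_)⟩
  · rw [symmDiff_comm]; exact hn.1.le
  · rw [symmDiff_comm]; exact hn.2.le

/-- A measure preserving map commuting with `U` and acting trivially on the `U`-invariant sets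
also acts trivially on the `U × U`-invariant sets of the relatively independent square. -/
theorem prodMap_preimage_ae_eq_relSquare (hU : MeasurePreserving U ν ν)
    (hV : MeasurePreserving V ν ν) (hUV : ∀ y, V (U y) = U (V y))
    (htriv : ∀ D, MeasurableSet[MeasurableSpace.invariants U] D → V ⁻¹' D =ᵐ[ν] D)
    {A : Set (Y × Y)} (hA : MeasurableSet A) (hUA : Prod.map U U ⁻¹' A = A) :
    Prod.map V V ⁻¹' A =ᵐ[relSquare ν (MeasurableSpace.invariants_le U)] A := by
  have hle := MeasurableSpace.invariants_le U
  have mS : MeasurableSet (Prod.swap ⁻¹' A) := measurable_swap hA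
  have hUS : Prod.map U U ⁻¹' (Prod.swap ⁻¹' A) = Prod.swap ⁻¹' A := by
    conv_rhs => rw [← hUA]
    rfl
  have key : ∀ ε : ℝ, 0 < ε → ∀ᵐ y ∂ν,
      ((condKernel ν hle y).prod (condKernel ν hle y)) ((Prod.map V V ⁻¹' A) ∆ A) ≤
        (ENNReal.ofReal ε + ENNReal.ofReal ε) + (ENNReal.ofReal ε + ENNReal.ofReal ε) := by
    intro ε hε
    set δ := ENNReal.ofReal ε + ENNReal.ofReal ε
    -- For each n, the set of points where n works is U-invariant up to null sets, so the n found at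
    -- y works for almost every z in its fibre.
    have hinv : ∀ n, ∀ᵐ y ∂ν, ∀ᵐ z ∂condKernel ν hle y,
        (z ∈ {z | sectionDist ν U A V U^[n] z ≤ δ ∧
          sectionDist ν U (Prod.swap ⁻¹' A) V U^[n] z ≤ δ} ↔
        y ∈ {z | sectionDist ν U A V U^[n] z ≤ δ ∧
          sectionDist ν U (Prod.swap ⁻¹' A) V U^[n] z ≤ δ}) := by
      intro n
      have hUn := hU.measurable.iterate n
      refine ae_ae_mem_iff_of_preimage_ae_eq hU
        ((measurableSet_le (measurable_sectionDist hA hV.measurable hUn) measurable_const).inter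
        (measurableSet_le (measurable_sectionDist mS hV.measurable hUn) measurable_const)) ?_
      filter_upwards [sectionDist_comp_ae_eq hU hUV hA hUA n,
        sectionDist_comp_ae_eq hU hUV mS hUS n] with z h1 h2
      refine propext ?_
      change (_ ∧ _) ↔ (_ ∧ _)
      rw [h1, h2]
    filter_upwards [ae_exists_sectionDist_le hU hV htriv hA mS hε, ae_all_iff.2 hinv,
      ae_ae_condKernel_eq (ν := ν) hle, ae_measurePreserving_condKernel hle hV htriv,
      ae_measurePreserving_condKernel hle hU (fun D hD => .of_eq hD.2)] with y ⟨n, hn⟩ h2 h3 h4 h5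
    refine measure_prodMap_preimage_symmDiff_le h5 h4 hA hUA n δ ?_ ?_
    · filter_upwards [h2 n, h3] with z hz hz'
      rw [← hz']
      exact (hz.2 hn).1
    · filter_upwards [h2 n, h3] with z hz hz'
      rw [← hz']
      exact (hz.2 hn).2
  have mD : MeasurableSet ((Prod.map V V ⁻¹' A) ∆ A) :=
    ((hV.measurable.prodMap hV.measurable) hA).symmDiff hA
  rw [← measure_symmDiff_eq_zero_iff, relSquare, Measure.bind_apply mD (Kernel.aemeasurable _),
    lintegral_eq_zero_iff (Kernel.measurable_coe _ mD)]
  filter_upwards [ae_all_iff.2 fun k : ℕ => key (1 / ((k : ℝ) + 1)) (by positivity)] with y hy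
  rw [Kernel.prod_apply]
  have hlim : Filter.Tendsto (fun k : ℕ => ENNReal.ofReal (1 / ((k : ℝ) + 1)))
      Filter.atTop (nhds 0) := by
    simpa using ENNReal.tendsto_ofReal tendsto_one_div_add_atTop_nhds_zero_nat
  have hlim' := (hlim.add hlim).add (hlim.add hlim)
  simp only [add_zero] at hlim'
  exact le_antisymm (ge_of_tendsto' hlim' hy) zero_le

end Recurrence

/-! ### Invariant σ-algebras modulo null sets -/

theorem ae_eq_map_of_preimage_ae_eq {Y Z : Type*} [MeasurableSpace Y] [MeasurableSpace Z]
    {ν : Measure Y} {c : Y → Z} (hc : Measurable c) {A B : Set Z} (hA : MeasurableSet A)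
    (hB : MeasurableSet B) (h : c ⁻¹' A =ᵐ[ν] c ⁻¹' B) : A =ᵐ[ν.map c] B := by
  rw [← measure_symmDiff_eq_zero_iff, Measure.map_apply hc (hA.symmDiff hB)]
  exact measure_symmDiff_eq_zero_iff.2 h

/-- A set that V fixes up to a null set differs by a null set from a strictly V-invariant one. -/
theorem invariants_le_eventuallyMeasurableSpace {Y : Type*} [MeasurableSpace Y] {ν : Measure Y}
    {U V : Y → Y} (hV : MeasurePreserving V ν ν)
    (htriv : ∀ D, MeasurableSet[MeasurableSpace.invariants U] D → V ⁻¹' D =ᵐ[ν] D) :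
    MeasurableSpace.invariants U ≤
      eventuallyMeasurableSpace (MeasurableSpace.invariants V) (ae ν) := by
  intro D hD
  obtain ⟨t, mt, htD, hVt⟩ := hV.quasiMeasurePreserving.exists_preimage_eq_of_preimage_ae
    hD.1.nullMeasurableSet (htriv D hD)
  exact ⟨t, ⟨mt, hVt⟩, htD.symm⟩

theorem eventuallyMeasurableSpace_mono {Y : Type*} {m₁ m₂ : MeasurableSpace Y} {l : Filter Y}
    [CountableInterFilter l] (h : m₁ ≤ eventuallyMeasurableSpace m₂ l) :
    eventuallyMeasurableSpace m₁ l ≤ eventuallyMeasurableSpace m₂ l := by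
  rintro s ⟨t, ht, hst⟩
  obtain ⟨u, hu, htu⟩ := h t ht
  exact ⟨u, hu, hst.trans htu⟩

/-! ### Induction over the cubes -/

section Cubes

variable {X : Type*}

theorem cubeMap_comp_glue (R : X → X) (k : ℕ) :
    cubeMap R (k + 1) ∘ glue X k = glue X k ∘ Prod.map (cubeMap R k) (cubeMap R k) := by
  funext p ε
  simp only [Function.comp_apply, cubeMap, glue, Prod.map_fst, Prod.map_snd]
  split_ifs <;> rfl

variable [MeasurableSpace X]

theorem measurable_cubeMap {R : X → X} (hR : Measurable R) (k : ℕ) : Measurable (cubeMap R k) :=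
  measurable_pi_lambda _ fun ε => hR.comp (measurable_pi_apply ε)

variable [StandardBorelSpace X] {μ : Measure X} [IsProbabilityMeasure μ]

theorem cubeMeasure_zero (T : X → X) : cubeMeasure μ T 0 = μ.map fun x _ => x := rfl

theorem cubeMeasure_succ (T : X → X) (k : ℕ) : cubeMeasure μ T (k + 1) =
    (relSquare (cubeMeasure μ T k) (cubeInvariants_le T k)).map (glue X k) := rfl

theorem measurePreserving_cubeMap_zero {T R : X → X} (hR : MeasurePreserving R μ μ) :
    MeasurePreserving (cubeMap R 0) (cubeMeasure μ T 0) (cubeMeasure μ T 0) := by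
  have hc : Measurable fun (x : X) (_ : Fin 0 → Bool) => x :=
    measurable_pi_lambda _ fun _ => measurable_id
  refine ⟨measurable_cubeMap hR.measurable 0, ?_⟩
  rw [cubeMeasure_zero, Measure.map_map (measurable_cubeMap hR.measurable 0) hc]
  conv_rhs => rw [← hR.map_eq, Measure.map_map hc hR.measurable]
  rfl

theorem preimage_cubeMap_zero_ae_eq {T R : X → X} (hT : Ergodic T μ) (hR : MeasurePreserving R μ μ)
    {A : Set (Cube X 0)} (hA : MeasurableSet[cubeInvariants T 0] A) :
    cubeMap R 0 ⁻¹' A =ᵐ[cubeMeasure μ T 0] A := by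
  have hc : Measurable fun (x : X) (_ : Fin 0 → Bool) => x :=
    measurable_pi_lambda _ fun _ => measurable_id
  refine ae_eq_map_of_preimage_ae_eq hc (measurable_cubeMap hR.measurable 0 hA.1) hA.1 ?_
  have hinv : T ⁻¹' ((fun (x : X) (_ : Fin 0 → Bool) => x) ⁻¹' A) =
      (fun (x : X) (_ : Fin 0 → Bool) => x) ⁻¹' A := by
    conv_rhs => rw [← hA.2]
    rfl
  change R ⁻¹' ((fun (x : X) (_ : Fin 0 → Bool) => x) ⁻¹' A) =ᵐ[μ] _
  rcases hT.toPreErgodic.ae_empty_or_univ (hc hA.1) hinv with h | h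
  · exact (hR.quasiMeasurePreserving.preimage_ae_eq h).trans h.symm
  · exact (hR.quasiMeasurePreserving.preimage_ae_eq h).trans h.symm

theorem measurePreserving_cubeMap_succ {T R : X → X} {k : ℕ}
    (hR : MeasurePreserving (cubeMap R k) (cubeMeasure μ T k) (cubeMeasure μ T k))
    (hRm : Measurable R) (htriv : ∀ A, MeasurableSet[cubeInvariants T k] A →
      cubeMap R k ⁻¹' A =ᵐ[cubeMeasure μ T k] A) :
    MeasurePreserving (cubeMap R (k + 1)) (cubeMeasure μ T (k + 1)) (cubeMeasure μ T (k + 1)) := by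
  have h := measurePreserving_relSquare (cubeInvariants_le T k) hR htriv
  refine ⟨measurable_cubeMap hRm _, ?_⟩
  rw [cubeMeasure_succ, Measure.map_map (measurable_cubeMap hRm _) (measurable_glue k),
    cubeMap_comp_glue, ← Measure.map_map (measurable_glue k) h.measurable, h.map_eq]

theorem preimage_cubeMap_succ_ae_eq {T R : X → X} {k : ℕ}
    (hT : MeasurePreserving (cubeMap T k) (cubeMeasure μ T k) (cubeMeasure μ T k))
    (hR : MeasurePreserving (cubeMap R k) (cubeMeasure μ T k) (cubeMeasure μ T k))
    (hRm : Measurable R) (hRT : ∀ x, R (T x) = T (R x))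
    (htriv : ∀ A, MeasurableSet[cubeInvariants T k] A →
      cubeMap R k ⁻¹' A =ᵐ[cubeMeasure μ T k] A)
    {A : Set (Cube X (k + 1))} (hA : MeasurableSet[cubeInvariants T (k + 1)] A) :
    cubeMap R (k + 1) ⁻¹' A =ᵐ[cubeMeasure μ T (k + 1)] A := by
  rw [cubeMeasure_succ]
  refine ae_eq_map_of_preimage_ae_eq (measurable_glue k) (measurable_cubeMap hRm _ hA.1) hA.1 ?_
  rw [← Set.preimage_comp, cubeMap_comp_glue, Set.preimage_comp]
  refine prodMap_preimage_ae_eq_relSquare hT hR (fun y => funext fun ε => hRT _) htriv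
    (measurable_glue k hA.1) ?_
  rw [← Set.preimage_comp, ← cubeMap_comp_glue, Set.preimage_comp, hA.2]

/-- A measure preserving map commuting with an ergodic `T` preserves the cube measures of `T` and
acts trivially on the invariant sets of the cubes. -/
theorem measurePreserving_and_preimage_ae_eq_of_commute {T R : X → X} (hT : Ergodic T μ)
    (hR : MeasurePreserving R μ μ) (hRT : ∀ x, R (T x) = T (R x)) (k : ℕ) :
    MeasurePreserving (cubeMap R k) (cubeMeasure μ T k) (cubeMeasure μ T k) ∧
      ∀ A, MeasurableSet[cubeInvariants T k] A →
        cubeMap R k ⁻¹' A =ᵐ[cubeMeasure μ T k] A := by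
  -- T^{[k]} fixes its own invariant sets exactly, so its invariance of the measures needs no
  -- triviality argument.
  have hTT : ∀ k, MeasurePreserving (cubeMap T k) (cubeMeasure μ T k) (cubeMeasure μ T k) := by
    intro k
    induction k with
    | zero => exact measurePreserving_cubeMap_zero hT.toMeasurePreserving
    | succ k ih => exact measurePreserving_cubeMap_succ ih hT.measurable fun A hA => .of_eq hA.2
  induction k with
  | zero => exact ⟨measurePreserving_cubeMap_zero hR, fun A hA => preimage_cubeMap_zero_ae_eq hT hR hA⟩
  | succ k ih => exact ⟨measurePreserving_cubeMap_succ ih.1 hR.measurable ih.2,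
      fun A hA => preimage_cubeMap_succ_ae_eq (hTT k) ih.1 hR.measurable hRT ih.2 hA⟩

theorem cubeInvariants_le_eventuallyMeasurableSpace {T R : X → X} (hT : Ergodic T μ)
    (hR : MeasurePreserving R μ μ) (hRT : ∀ x, R (T x) = T (R x)) (k : ℕ) :
    cubeInvariants T k ≤
      eventuallyMeasurableSpace (cubeInvariants R k) (ae (cubeMeasure μ T k)) :=
  have h := measurePreserving_and_preimage_ae_eq_of_commute hT hR hRT k
  invariants_le_eventuallyMeasurableSpace h.1 h.2

theorem cubeMeasure_eq_of_commute {T S : X → X} (hT : Ergodic T μ) (hS : Ergodic S μ)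
    (hTS : ∀ x, T (S x) = S (T x)) (k : ℕ) : cubeMeasure μ T k = cubeMeasure μ S k := by
  induction k with
  | zero => rfl
  | succ k ih =>
    have h₁ := cubeInvariants_le_eventuallyMeasurableSpace hT hS.toMeasurePreserving
      (fun x => (hTS x).symm) k
    have h₂ := cubeInvariants_le_eventuallyMeasurableSpace hS hT.toMeasurePreserving hTS k
    -- Both inclusions must hold modulo null sets of the same measure.
    simp only [← ih] at h₂
    rw [cubeMeasure_succ, cubeMeasure_succ,
      relSquare_eq_of_ae_eq (cubeInvariants_le T k) (cubeInvariants_le S k) h₁ h₂]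
    simp only [ih]

/-- An S^{[k]}-invariant set agrees up to a null set with a T^{[k]}-invariant one, so triviality of
R^{[k]} transfers because R^{[k]} preserves the common measure. -/
theorem groupG_subset_of_commute {T S : X → X} (hT : Ergodic T μ) (hS : Ergodic S μ)
    (hTS : ∀ x, T (S x) = S (T x)) : groupG μ T ⊆ groupG μ S := by
  refine fun R hR => ⟨hR.1, fun k hk => ?_⟩
  rw [← cubeMeasure_eq_of_commute hT hS hTS k]
  refine ⟨(hR.2 k hk).1, fun A hA => ?_⟩
  have h := cubeInvariants_le_eventuallyMeasurableSpace hS hT.toMeasurePreserving hTS k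
  simp only [← cubeMeasure_eq_of_commute hT hS hTS k] at h
  obtain ⟨B, hB, hAB⟩ := h A hA
  exact ((hR.2 k hk).1.quasiMeasurePreserving.preimage_ae_eq hAB).trans
    (((hR.2 k hk).2 B hB).trans hAB.symm)

theorem seminorm_eq_of_commute {T S : X → X} (hT : Ergodic T μ) (hS : Ergodic S μ)
    (hTS : ∀ x, T (S x) = S (T x)) (k : ℕ) : seminorm μ T k = seminorm μ S k := by
  funext f
  rw [seminorm, seminorm, cubeMeasure_eq_of_commute hT hS hTS k]

end Cubes

end HostKra

/-! ### The proposition -/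

theorem mainTheorem6 {X : Type*} [MeasurableSpace X] [StandardBorelSpace X]
    (μ : Measure X) [IsProbabilityMeasure μ] (T S : X ≃ᵐ X)
    (hT : Ergodic T μ) (hS : Ergodic S μ) (hTS : ∀ x, T (S x) = S (T x)) :
    S ∈ HostKra.groupG μ T ∧
    HostKra.groupG μ T = HostKra.groupG μ S ∧
    ∀ k : ℕ,
      HostKra.cubeMeasure μ T k = HostKra.cubeMeasure μ S k ∧
      eventuallyMeasurableSpace (HostKra.cubeInvariants T k) (ae (HostKra.cubeMeasure μ T k)) =
        eventuallyMeasurableSpace (HostKra.cubeInvariants S k) (ae (HostKra.cubeMeasure μ S k)) ∧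
      (1 ≤ k → ∀ f : X → ℝ, MemLp f ⊤ μ →
        HostKra.seminorm μ T k f = HostKra.seminorm μ S k f) ∧
      HostKra.factorZ μ T k = HostKra.factorZ μ S k := by
  have hST : ∀ x, S (T x) = T (S x) := fun x => (hTS x).symm
  have hμ := HostKra.cubeMeasure_eq_of_commute hT hS hTS
  refine ⟨⟨hS.toMeasurePreserving, fun k _ =>
    HostKra.measurePreserving_and_preimage_ae_eq_of_commute hT hS.toMeasurePreserving hST k⟩,
    (HostKra.groupG_subset_of_commute hT hS hTS).antisymm
      (HostKra.groupG_subset_of_commute hS hT hST),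
    fun k => ⟨hμ k, ?_, fun _ f _ => by rw [HostKra.seminorm_eq_of_commute hT hS hTS k], ?_⟩⟩
  · have h₁ := HostKra.cubeInvariants_le_eventuallyMeasurableSpace hT hS.toMeasurePreserving hST k
    have h₂ := HostKra.cubeInvariants_le_eventuallyMeasurableSpace hS hT.toMeasurePreserving hTS k
    simp only [← hμ k] at h₂ ⊢
    exact (HostKra.eventuallyMeasurableSpace_mono h₁).antisymm
      (HostKra.eventuallyMeasurableSpace_mono h₂)
  · rw [HostKra.factorZ, HostKra.factorZ, HostKra.seminorm_eq_of_commute hT hS hTS (k + 1)]
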